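/- Let $\lambda$ be a non-zero cardinal, let $P_\lambda$ be the polycyclic monoid on $\lambda$ generators, i.e. the monoid with zero given by the presentation $$P_\lambda=\big\langle \{p_i\}_{i\in\lambda},\{p_i^{-1}\}_{i\in\lambda}\mid p_ip_i^{-1}=1,\ p_ip_j^{-1}=0\text{ for } i\neq j\big\rangle,$$ and let $\mathscr M_\lambda$ be the free monoid on the set $\{p_i\}_{i\in\lambda}$. For a word $a=p_{i_1}\cdots p_{i_n}\in\mathscr M_\lambda$ write $a^{-1}=p_{i_n}^{-1}\cdots p_{i_1}^{-1}$. Let $\tau_{\mathsf{mi}}$ be the topology on $P_\lambda$ in which every non-zero element is isolated and in which the sets $$U_A(0)=\{0\}\cup\{a^{-1}b : a,b\in\mathscr M_\lambda\setminus A\},\qquad A\subseteq \mathscr M_\lambda\text{ finite},$$ form a base at $0$. An inverse semigroup is a semigroup in which every element $a$ has a unique inverse, i.e. there is a unique $a^{-1}$ with $aa^{-1}a=a$ and $a^{-1}aa^{-1}=a^{-1}$. A topological inverse semigroup is an inverse semigroup with a Hausdorff topology for which multiplication and inversion are continuous. A topological inverse semigroup $S$ is $H$-closed in the class of topological inverse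 semigroups if $S$ is closed in every topological inverse semigroup $T$ that contains $S$ both as a subsemigroup and as a topological subspace. It is absolutely $H$-closed in this class if for every continuous homomorphism $h\colon S\to T$ into a topological inverse semigroup $T$ the image $h(S)$, with the subspace topology from $T$, is $H$-closed in this class. Then $(P_\lambda,\tau_{\mathsf{mi}})$ is a (Hausdorff) topological inverse semigroup, and it is absolutely $H$-closed in the class of topological inverse semigroups. -/

import Mathlib

open Topology

/-- `b` is an inverse of `a` in the semigroup `S`. -/
def IsSemigroupInverse {S : Type*} [Semigroup S] (a b : S) : Prop :=
  a * b * a = a ∧ b * a * b = b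

/-- An inverse semigroup: every element has a unique inverse. -/
def IsInverseSemigroup (S : Type*) [Semigroup S] : Prop :=
  ∀ a : S, ∃! b : S, IsSemigroupInverse a b

/-- The inversion `a ↦ a⁻¹` of an inverse semigroup. -/
noncomputable def IsInverseSemigroup.inversion {S : Type*} [Semigroup S]
    (h : IsInverseSemigroup S) (a : S) : S :=
  (h a).choose

/-- A topological inverse semigroup: a Hausdorff space with the structure of an inverse semigroup
whose multiplication and inversion are continuous. -/
structure IsTopologicalInverseSemigroup (S : Type*) [Semigroup S] [TopologicalSpace S] :
    Prop where
  hausdorff : T2Space S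
  inverse : IsInverseSemigroup S
  continuous_mul : Continuous fun x : S × S => x.1 * x.2
  continuous_inversion : Continuous inverse.inversion

universe u v w

/-- `S` is `H`-closed in the class of topological inverse semigroups: it belongs to the class, and
it is closed in every topological inverse semigroup `T` that contains it as a subsemigroup and
as a topological space. -/
def IsHClosed (S : Type u) [Semigroup S] [TopologicalSpace S] : Prop :=
  IsTopologicalInverseSemigroup S ∧
    ∀ (T : Type v) [Semigroup T] [TopologicalSpace T], IsTopologicalInverseSemigroup T →
      ∀ f : S →ₙ* T, IsEmbedding f → IsClosed (Set.range f)

/-- `S` is absolutely `H`-closed in the class of topological inverse semigroups: it belongs to the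
class, and for every continuous homomorphism `h` of `S` into a topological inverse semigroup `T`
the image `h(S)`, a subsemigroup and a subspace of `T`, is `H`-closed in the class. -/
def IsAbsolutelyHClosed (S : Type u) [Semigroup S] [TopologicalSpace S] : Prop :=
  IsTopologicalInverseSemigroup S ∧
    ∀ (T : Type v) [Semigroup T] [TopologicalSpace T], IsTopologicalInverseSemigroup T →
      ∀ h : S →ₙ* T, Continuous h → IsHClosed.{v, w} h.srange

/-- The defining relations of the polycyclic monoid: `pᵢ pᵢ⁻¹ = 1`, and `pᵢ pⱼ⁻¹ = 0` for `i ≠ j`.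
The letter `Sum.inl i` stands for `pᵢ` and `Sum.inr i` for `pᵢ⁻¹`; the relations live on the free
monoid with zero on these letters. -/
inductive PolycyclicRel (ι : Type u) :
    WithZero (FreeMonoid (ι ⊕ ι)) → WithZero (FreeMonoid (ι ⊕ ι)) → Prop
  | eq_one (i : ι) :
      PolycyclicRel ι
        (((FreeMonoid.of (Sum.inl i) * FreeMonoid.of (Sum.inr i) : FreeMonoid (ι ⊕ ι))) :
          WithZero (FreeMonoid (ι ⊕ ι))) 1
  | eq_zero (i j : ι) (hij : i ≠ j) :
      PolycyclicRel ι
        (((FreeMonoid.of (Sum.inl i) * FreeMonoid.of (Sum.inr j) : FreeMonoid (ι ⊕ ι))) :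
          WithZero (FreeMonoid (ι ⊕ ι))) 0

/-- The polycyclic monoid `P_λ`, for `λ` the cardinality of `ι`, given by its presentation as a
monoid with zero. -/
def PolycyclicMonoid (ι : Type u) : Type u :=
  (conGen (PolycyclicRel ι)).Quotient

namespace PolycyclicMonoid

variable {ι : Type u}

instance : Monoid (PolycyclicMonoid ι) :=
  inferInstanceAs (Monoid (conGen (PolycyclicRel ι)).Quotient)

/-- The quotient map of the presentation. -/
def mk : WithZero (FreeMonoid (ι ⊕ ι)) →* PolycyclicMonoid ι :=
  (conGen (PolycyclicRel ι)).mk'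

theorem mk_surjective : Function.Surjective (mk (ι := ι)) :=
  Con.mk'_surjective

instance : MonoidWithZero (PolycyclicMonoid ι) where
  zero := mk 0
  zero_mul x := by
    obtain ⟨y, rfl⟩ := mk_surjective x
    change mk 0 * mk y = mk 0
    rw [← map_mul, zero_mul]
  mul_zero x := by
    obtain ⟨y, rfl⟩ := mk_surjective x
    change mk y * mk 0 = mk 0
    rw [← map_mul, mul_zero]

/-- The generator `pᵢ`. -/
def p (i : ι) : PolycyclicMonoid ι :=
  mk ((FreeMonoid.of (Sum.inl i) : FreeMonoid (ι ⊕ ι)) : WithZero (FreeMonoid (ι ⊕ ι)))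

/-- The generator `pᵢ⁻¹`. -/
def pInv (i : ι) : PolycyclicMonoid ι :=
  mk ((FreeMonoid.of (Sum.inr i) : FreeMonoid (ι ⊕ ι)) : WithZero (FreeMonoid (ι ⊕ ι)))

/-- A word `a = i₁ ⋯ iₙ` of the free monoid `M_λ` as the element `p_{i₁} ⋯ p_{iₙ}` of `P_λ`. -/
def word (a : FreeMonoid ι) : PolycyclicMonoid ι :=
  FreeMonoid.lift p a

/-- For a word `a = i₁ ⋯ iₙ`, the element `a⁻¹ = p_{iₙ}⁻¹ ⋯ p_{i₁}⁻¹` of `P_λ`. -/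
def wordInv (a : FreeMonoid ι) : PolycyclicMonoid ι :=
  FreeMonoid.lift pInv a.reverse

/-- The basic neighbourhood `U_A(0)` of zero: zero itself and all `a⁻¹b` with `a, b ∈ M_λ \ A`. -/
def basicNhd (A : Finset (FreeMonoid ι)) : Set (PolycyclicMonoid ι) :=
  {0} ∪ {x | ∃ a b : FreeMonoid ι, a ∉ A ∧ b ∉ A ∧ x = wordInv a * word b}

theorem basicNhd_anti {A B : Finset (FreeMonoid ι)} (h : A ⊆ B) :
    basicNhd B ⊆ basicNhd A := by
  rintro x (hx | ⟨a, b, ha, hb, rfl⟩)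
  · exact Or.inl hx
  · exact Or.inr ⟨a, b, fun h' => ha (h h'), fun h' => hb (h h'), rfl⟩

/-- The topology `τ_mi`: every non-zero element is isolated, and the sets `U_A(0)`, for `A` a finite
subset of `M_λ`, form a base at zero. -/
instance tauMi : TopologicalSpace (PolycyclicMonoid ι) where
  IsOpen s := (0 : PolycyclicMonoid ι) ∈ s → ∃ A : Finset (FreeMonoid ι), basicNhd A ⊆ s
  isOpen_univ _ := ⟨∅, Set.subset_univ _⟩
  isOpen_inter s t hs ht h0 := by
    classical
    obtain ⟨A, hA⟩ := hs h0.1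
    obtain ⟨B, hB⟩ := ht h0.2
    exact ⟨A ∪ B, Set.subset_inter
      ((basicNhd_anti Finset.subset_union_left).trans hA)
      ((basicNhd_anti Finset.subset_union_right).trans hB)⟩
  isOpen_sUnion S hS h0 := by
    obtain ⟨s, hs, h0s⟩ := h0
    obtain ⟨A, hA⟩ := hS s hs h0s
    exact ⟨A, hA.trans (Set.subset_sUnion_of_mem hs)⟩

theorem isOpen_singleton_of_ne_zero {x : PolycyclicMonoid ι} (hx : x ≠ 0) :
    IsOpen ({x} : Set (PolycyclicMonoid ι)) :=
  fun h0 => absurd (Set.mem_singleton_iff.mp h0).symm hx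

theorem nhds_zero_hasBasis :
    (𝓝 (0 : PolycyclicMonoid ι)).HasBasis (fun _ : Finset (FreeMonoid ι) => True) basicNhd := by
  refine ⟨fun s => ?_⟩
  rw [mem_nhds_iff]
  constructor
  · rintro ⟨t, hts, ht, h0⟩
    obtain ⟨A, hA⟩ := ht h0
    exact ⟨A, trivial, hA.trans hts⟩
  · rintro ⟨A, -, hA⟩
    exact ⟨basicNhd A, hA, fun _ => ⟨A, subset_rfl⟩, Or.inl rfl⟩

end PolycyclicMonoid

/-!
The elements of the polycyclic monoid are `0` and the normal forms `a⁻¹b`, where `a` and `b` are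
words. Existence of the normal form follows from the multiplication rule `normalForm_mul`.
Uniqueness (`normalForm_inj`) comes from a representation on the functions on the free monoid, where
`pᵢ` acts by a shift and `pᵢ⁻¹` by the opposite shift, extended by zero. The inverse of `a⁻¹b` is
`b⁻¹a`.

A map tends to `0` in `τ_mi` if and only if, for each word `c`, it eventually avoids both the
`ℛ`-class `{c⁻¹b}` and the `ℒ`-class `{a⁻¹c}` (`tendsto_zero_iff`). Continuity of the multiplication
amounts to finiteness statements: when `xy` lies in the `ℛ`-class of `c`, the left word of `x` is
one of the finitely many suffixes of `c`, and dually on the other side.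

For absolute `H`-closedness it suffices that every continuous homomorphism `g` from `P_λ` to a
topological inverse semigroup has closed range. Let `g` tend to `x` along an ultrafilter `U` on
`P_λ`. If some `ℛ`-class and some `ℒ`-class belong to `U`, then so does their intersection, which is
a single point `s`, and `x = g s`. If no `ℛ`-class belongs to `U`, then `s s⁻¹` tends to `0` along
`U`, because for `s = a⁻¹b` it equals `a⁻¹a`, both of whose words are the left word of `s`.
Continuity gives `x x⁻¹ = g 0`, so `x = x x⁻¹ x = g 0 * x = g 0`. The case of `ℒ`-classes is dual.
-/

/-! ### Inverse semigroups -/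

namespace IsInverseSemigroup

variable {S : Type*} [Semigroup S] (h : IsInverseSemigroup S)

theorem inversion_spec (a : S) : IsSemigroupInverse a (h.inversion a) :=
  (h a).choose_spec.1

theorem eq_inversion {a b : S} (hb : IsSemigroupInverse a b) : b = h.inversion a :=
  (h a).choose_spec.2 b hb

theorem map_inversion {T : Type*} [Semigroup T] (hT : IsInverseSemigroup T) (f : S →ₙ* T) (a : S) :
    f (h.inversion a) = hT.inversion (f a) := by
  apply hT.eq_inversion
  obtain ⟨h1, h2⟩ := h.inversion_spec a
  exact ⟨by rw [← map_mul, ← map_mul, h1], by rw [← map_mul, ← map_mul, h2]⟩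

end IsInverseSemigroup

theorem IsInverseSemigroup.srange {S T : Type*} [Semigroup S] [Semigroup T]
    (hS : IsInverseSemigroup S) (hT : IsInverseSemigroup T) (f : S →ₙ* T) :
    IsInverseSemigroup f.srange := by
  rintro ⟨_, s, rfl⟩
  obtain ⟨h1, h2⟩ := hS.inversion_spec s
  refine ⟨⟨f (hS.inversion s), _, rfl⟩, ⟨?_, ?_⟩, ?_⟩
  · exact Subtype.ext (by
      change f s * f (hS.inversion s) * f s = f s
      rw [← map_mul, ← map_mul, h1])
  · exact Subtype.ext (by
      change f (hS.inversion s) * f s * f (hS.inversion s) = f (hS.inversion s)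
      rw [← map_mul, ← map_mul, h2])
  · rintro ⟨y, hy⟩ ⟨h3, h4⟩
    refine Subtype.ext ?_
    change y = f (hS.inversion s)
    rw [hS.map_inversion hT]
    exact hT.eq_inversion ⟨congrArg Subtype.val h3, congrArg Subtype.val h4⟩

/-- The image of an inverse semigroup in a topological inverse semigroup is again a topological
inverse semigroup, because its inversion is the restriction of the ambient one. -/
theorem IsTopologicalInverseSemigroup.srange {S T : Type*} [Semigroup S] [Semigroup T]
    [TopologicalSpace T] (hS : IsInverseSemigroup S) (hT : IsTopologicalInverseSemigroup T)
    (f : S →ₙ* T) : IsTopologicalInverseSemigroup f.srange where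
  hausdorff := by
    have := hT.hausdorff
    infer_instance
  inverse := hS.srange hT.inverse f
  continuous_mul := by
    refine continuous_induced_rng.2 ?_
    exact hT.continuous_mul.comp
      ((continuous_subtype_val.comp continuous_fst).prodMk
        (continuous_subtype_val.comp continuous_snd))
  continuous_inversion := by
    refine continuous_induced_rng.2 ?_
    convert hT.continuous_inversion.comp continuous_subtype_val using 1
    ext x
    exact (hS.srange hT.inverse f).map_inversion hT.inverse (MulMemClass.subtype f.srange) x

/-! ### Normal forms in the polycyclic monoid -/

theorem FreeMonoid.eq_one_or_eq_mul_of {α : Type*} (a : FreeMonoid α) :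
    a = 1 ∨ ∃ (b : FreeMonoid α) (i : α), a = b * FreeMonoid.of i := by
  obtain h | ⟨b, i, h⟩ := List.eq_nil_or_concat (FreeMonoid.toList a)
  · exact Or.inl h
  · exact Or.inr ⟨FreeMonoid.ofList b, i, h.trans List.concat_eq_append⟩

theorem FreeMonoid.finite_suffixes {α : Type*} (c : FreeMonoid α) :
    {n : FreeMonoid α | ∃ e, c = e * n}.Finite := by
  refine ((FreeMonoid.toList c).tails.finite_toSet).subset ?_
  rintro n ⟨e, rfl⟩
  exact (List.mem_tails _ _).2 ⟨e, rfl⟩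

namespace PolycyclicMonoid

variable {ι : Type u}

theorem p_mul_pInv (i : ι) : p i * pInv i = 1 := by
  have h : mk (ι := ι) _ = mk _ := (Con.eq _).2 (ConGen.Rel.of _ _ (PolycyclicRel.eq_one i))
  rw [WithZero.coe_mul, map_mul, map_one] at h
  exact h

theorem p_mul_pInv_of_ne {i j : ι} (hij : i ≠ j) : p i * pInv j = 0 := by
  have h : mk (ι := ι) _ = mk _ := (Con.eq _).2 (ConGen.Rel.of _ _ (PolycyclicRel.eq_zero i j hij))
  rw [WithZero.coe_mul, map_mul] at h
  exact h

@[simp] theorem word_one : word (1 : FreeMonoid ι) = 1 := map_one _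

@[simp] theorem word_mul (a b : FreeMonoid ι) : word (a * b) = word a * word b := map_mul _ _ _

@[simp] theorem word_of (i : ι) : word (FreeMonoid.of i) = p i := FreeMonoid.lift_eval_of _ _

@[simp] theorem wordInv_one : wordInv (1 : FreeMonoid ι) = 1 := map_one _

@[simp] theorem wordInv_mul (a b : FreeMonoid ι) : wordInv (a * b) = wordInv b * wordInv a := by
  simp only [wordInv, FreeMonoid.reverse_mul, map_mul]

@[simp] theorem wordInv_of (i : ι) : wordInv (FreeMonoid.of i) = pInv i :=
  FreeMonoid.lift_eval_of _ _

@[simp] theorem word_mul_wordInv_self (a : FreeMonoid ι) : word a * wordInv a = 1 := by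
  induction a using FreeMonoid.inductionOn' with
  | one => simp
  | of_mul i a ih =>
    rw [word_mul, wordInv_mul, mul_assoc, ← mul_assoc (word a), ih, one_mul, word_of, wordInv_of,
      p_mul_pInv]

/-- The product `bc⁻¹` is a word or an inverse word if one of `b`, `c` is a suffix of the other, and
zero otherwise. -/
theorem word_mul_wordInv (b c : FreeMonoid ι) :
    (∃ e, b = e * c) ∨ (∃ e, c = e * b) ∨ word b * wordInv c = 0 := by
  induction hn : b.length generalizing b c with
  | zero => exact Or.inr (Or.inl ⟨c, by rw [FreeMonoid.length_eq_zero.1 hn, mul_one]⟩)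
  | succ n ih =>
    obtain rfl | ⟨b, i, rfl⟩ := b.eq_one_or_eq_mul_of
    · simp at hn
    obtain rfl | ⟨c, j, rfl⟩ := c.eq_one_or_eq_mul_of
    · exact Or.inl ⟨_, (mul_one _).symm⟩
    have key : word (b * FreeMonoid.of i) * wordInv (c * FreeMonoid.of j)
        = word b * (p i * pInv j) * wordInv c := by
      simp [mul_assoc]
    rcases eq_or_ne i j with rfl | hij
    · rw [p_mul_pInv, mul_one] at key
      obtain ⟨e, h⟩ | ⟨e, h⟩ | h := ih b c (by simpa using hn)
      · exact Or.inl ⟨e, by rw [h, mul_assoc]⟩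
      · exact Or.inr (Or.inl ⟨e, by rw [h, mul_assoc]⟩)
      · exact Or.inr (Or.inr (key.trans h))
    · rw [p_mul_pInv_of_ne hij, mul_zero, zero_mul] at key
      exact Or.inr (Or.inr key)

/-- The element `a⁻¹b`. -/
def normalForm (a b : FreeMonoid ι) : PolycyclicMonoid ι := wordInv a * word b

theorem normalForm_mul (a b c d : FreeMonoid ι) :
    (∃ e, b = e * c ∧ normalForm a b * normalForm c d = normalForm a (e * d)) ∨
    (∃ e, c = e * b ∧ normalForm a b * normalForm c d = normalForm (e * a) d) ∨
    normalForm a b * normalForm c d = 0 := by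
  have assoc : normalForm a b * normalForm c d = wordInv a * (word b * wordInv c) * word d := by
    simp only [normalForm, mul_assoc]
  obtain ⟨e, rfl⟩ | ⟨e, rfl⟩ | h := word_mul_wordInv b c
  · refine Or.inl ⟨e, rfl, ?_⟩
    rw [assoc, word_mul, mul_assoc (word e), word_mul_wordInv_self, normalForm, word_mul, mul_one,
      mul_assoc]
  · refine Or.inr (Or.inl ⟨e, rfl, ?_⟩)
    rw [assoc, wordInv_mul, ← mul_assoc (word b), word_mul_wordInv_self, normalForm, wordInv_mul,
      one_mul]
  · exact Or.inr (Or.inr (by rw [assoc, h, mul_zero, zero_mul]))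

theorem normalForm_mul_normalForm (a b c : FreeMonoid ι) :
    normalForm a b * normalForm b c = normalForm a c := by
  rw [normalForm, normalForm, mul_assoc, ← mul_assoc (word b), word_mul_wordInv_self, one_mul,
    normalForm]

theorem eq_zero_or_eq_normalForm (x : PolycyclicMonoid ι) :
    x = 0 ∨ ∃ a b, x = normalForm a b := by
  obtain ⟨y, rfl⟩ := mk_surjective x
  induction y with
  | zero => exact Or.inl rfl
  | coe y =>
    induction y using FreeMonoid.inductionOn with
    | one => exact Or.inr ⟨1, 1, by simp [normalForm]⟩
    | of i =>
      right
      rcases i with i | i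
      · exact ⟨1, FreeMonoid.of i, by simp [normalForm]; rfl⟩
      · exact ⟨FreeMonoid.of i, 1, by simp [normalForm]; rfl⟩
    | mul y z hy hz =>
      rw [WithZero.coe_mul, map_mul]
      obtain hy | ⟨a, b, hy⟩ := hy
      · exact Or.inl (by rw [hy, zero_mul])
      obtain hz | ⟨c, d, hz⟩ := hz
      · exact Or.inl (by rw [hz, mul_zero])
      rw [hy, hz]
      obtain ⟨e, -, h⟩ | ⟨e, -, h⟩ | h := normalForm_mul a b c d
      · exact Or.inr ⟨_, _, h⟩
      · exact Or.inr ⟨_, _, h⟩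
      · exact Or.inl h

/-- The action of the letters on integer-valued functions on words: `pᵢ` sends `f` to
`w ↦ f (w i)`, and `pᵢ⁻¹` sends `f` to the function with value `f w` at `w i` and zero at the words
not ending in `i`. -/
noncomputable def letterAction : ι ⊕ ι → Module.End ℤ (FreeMonoid ι → ℤ)
  | Sum.inl i => LinearMap.funLeft ℤ ℤ (· * FreeMonoid.of i)
  | Sum.inr i => Function.ExtendByZero.linearMap ℤ (· * FreeMonoid.of i)

/-- The representation of the polycyclic monoid on integer-valued functions on words. -/
noncomputable def representation : PolycyclicMonoid ι →* Module.End ℤ (FreeMonoid ι → ℤ) :=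
  Con.lift (conGen (PolycyclicRel ι))
    (WithZero.lift' (FreeMonoid.lift letterAction)).toMonoidHom (by
      rw [Con.conGen_le]
      rintro _ _ (i | ⟨i, j, hij⟩)
      · refine LinearMap.ext fun f => funext fun w => ?_
        simp only [map_mul, WithZero.coe_mul]
        exact (mul_left_injective (FreeMonoid.of i)).extend_apply f (0 : FreeMonoid ι → ℤ) w
      · refine LinearMap.ext fun f => funext fun w => ?_
        simp only [map_mul, WithZero.coe_mul]
        refine Function.extend_apply' f (0 : FreeMonoid ι → ℤ) (w * FreeMonoid.of i) ?_
        rintro ⟨v, hv⟩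
        exact hij (List.append_inj_right' hv rfl |> List.singleton_inj.1).symm)

theorem representation_zero : representation (0 : PolycyclicMonoid ι) = 0 := rfl

theorem representation_p (i : ι) (f : FreeMonoid ι → ℤ) (w : FreeMonoid ι) :
    representation (p i) f w = f (w * FreeMonoid.of i) := rfl

theorem representation_pInv (i : ι) (f : FreeMonoid ι → ℤ) :
    representation (pInv i) f = Function.extend (· * FreeMonoid.of i) f 0 := rfl

theorem representation_word (b : FreeMonoid ι) (f : FreeMonoid ι → ℤ) (w : FreeMonoid ι) :
    representation (word b) f w = f (w * b) := by
  induction b using FreeMonoid.inductionOn' generalizing w with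
  | one => simp
  | of_mul i b ih =>
    rw [word_mul, map_mul, word_of, Module.End.mul_apply, representation_p, ih, mul_assoc]

theorem representation_wordInv (a : FreeMonoid ι) (f : FreeMonoid ι → ℤ) (w : FreeMonoid ι) :
    representation (wordInv a) f (w * a) = f w := by
  induction a using FreeMonoid.inductionOn' generalizing f w with
  | one => simp
  | of_mul i a ih =>
    rw [wordInv_mul, map_mul, wordInv_of, Module.End.mul_apply, ← mul_assoc, ih,
      representation_pInv]
    exact (mul_left_injective (FreeMonoid.of i)).extend_apply f (0 : FreeMonoid ι → ℤ) w

theorem exists_eq_mul_of_representation_wordInv_ne_zero {a w : FreeMonoid ι}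
    {f : FreeMonoid ι → ℤ} (h : representation (wordInv a) f w ≠ 0) : ∃ v, w = v * a := by
  induction a using FreeMonoid.inductionOn' generalizing f w with
  | one => exact ⟨w, (mul_one w).symm⟩
  | of_mul i a ih =>
    rw [wordInv_mul, map_mul, wordInv_of, Module.End.mul_apply] at h
    obtain ⟨v, rfl⟩ := ih h
    rw [representation_wordInv, representation_pInv] at h
    by_contra hv
    refine h (Function.extend_apply' f (0 : FreeMonoid ι → ℤ) v ?_)
    rintro ⟨u, rfl⟩
    exact hv ⟨u, mul_assoc _ _ _⟩

theorem representation_normalForm (a b : FreeMonoid ι) (f : FreeMonoid ι → ℤ) (w : FreeMonoid ι) :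
    representation (normalForm a b) f (w * a) = f (w * b) := by
  rw [normalForm, map_mul, Module.End.mul_apply, representation_wordInv, representation_word]

theorem normalForm_ne_zero (a b : FreeMonoid ι) : normalForm a b ≠ 0 := by
  intro h
  have h1 := representation_normalForm a b (fun _ => 1) 1
  rw [h, representation_zero] at h1
  exact zero_ne_one h1

theorem exists_mul_of_normalForm_eq {a b c d : FreeMonoid ι}
    (h : normalForm a b = normalForm c d) : ∃ v, a = v * c ∧ b = v * d := by
  classical
  -- The function supported at `b` is sent by `a⁻¹b` to one that does not vanish at `a`.
  have h1 := representation_normalForm a b (Pi.single b 1) 1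
  rw [one_mul, one_mul, Pi.single_eq_same, h] at h1
  have h2 : representation (normalForm c d) (Pi.single b 1) a ≠ 0 := by
    rw [h1]
    exact one_ne_zero
  rw [normalForm, map_mul, Module.End.mul_apply] at h2
  obtain ⟨v, rfl⟩ := exists_eq_mul_of_representation_wordInv_ne_zero h2
  refine ⟨v, rfl, ?_⟩
  rw [representation_normalForm] at h1
  by_contra hb
  rw [Pi.single_eq_of_ne (Ne.symm hb)] at h1
  exact zero_ne_one h1

theorem normalForm_inj {a b c d : FreeMonoid ι} :
    normalForm a b = normalForm c d ↔ a = c ∧ b = d := by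
  refine ⟨fun h => ?_, fun ⟨h1, h2⟩ => by rw [h1, h2]⟩
  obtain ⟨v, h1, h2⟩ := exists_mul_of_normalForm_eq h
  obtain ⟨u, h3, -⟩ := exists_mul_of_normalForm_eq h.symm
  have hv : v = 1 := by
    have h4 := congrArg FreeMonoid.length h1
    have h5 := congrArg FreeMonoid.length h3
    rw [FreeMonoid.length_mul] at h4 h5
    exact FreeMonoid.length_eq_zero.1 (by omega)
  rw [hv, one_mul] at h1 h2
  exact ⟨h1, h2⟩

/-! ### Inversion in the polycyclic monoid -/

theorem isSemigroupInverse_normalForm (a b : FreeMonoid ι) :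
    IsSemigroupInverse (normalForm a b) (normalForm b a) := by
  constructor <;> simp only [normalForm_mul_normalForm]

theorem eq_one_of_mul_eq_one {u v : PolycyclicMonoid ι} (huv : u * v = 1) (hvu : v * u = 1) :
    u = 1 := by
  have one_eq : (1 : PolycyclicMonoid ι) = normalForm 1 1 := by simp [normalForm]
  obtain rfl | ⟨a, b, rfl⟩ := eq_zero_or_eq_normalForm u
  · rw [← huv, zero_mul]
  have ha : normalForm a a = normalForm 1 1 := by
    rw [← one_eq, ← mul_one (normalForm a a), ← huv, ← mul_assoc, normalForm_mul_normalForm]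
  have hb : normalForm b b = normalForm 1 1 := by
    rw [← one_eq, ← one_mul (normalForm b b), ← hvu, mul_assoc, normalForm_mul_normalForm]
  rw [(normalForm_inj.1 ha).1, (normalForm_inj.1 hb).1, ← one_eq]

theorem eq_of_word_mul_wordInv_eq_one {b c : FreeMonoid ι} (h : word b * wordInv c = 1) :
    b = c := by
  have h1 : normalForm 1 b = normalForm 1 c := by
    obtain ⟨e, rfl⟩ | ⟨e, rfl⟩ | h0 := word_mul_wordInv b c
    · rw [word_mul, mul_assoc, word_mul_wordInv_self, mul_one] at h
      simp [normalForm, h]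
    · rw [wordInv_mul, ← mul_assoc, word_mul_wordInv_self, one_mul] at h
      have he := word_mul_wordInv_self e
      rw [h, mul_one] at he
      simp only [normalForm, word_mul, he, one_mul]
    · exact absurd (by simp [normalForm, ← h, h0]) (normalForm_ne_zero (1 : FreeMonoid ι) 1)
  exact (normalForm_inj.1 h1).2

theorem isInverseSemigroup : IsInverseSemigroup (PolycyclicMonoid ι) := by
  intro x
  obtain rfl | ⟨a, b, rfl⟩ := eq_zero_or_eq_normalForm x
  · refine ⟨0, ⟨by simp, by simp⟩, ?_⟩
    rintro y ⟨-, h⟩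
    rw [← h, mul_zero, zero_mul]
  refine ⟨_, isSemigroupInverse_normalForm a b, ?_⟩
  rintro y ⟨h1, h2⟩
  obtain rfl | ⟨c, d, rfl⟩ := eq_zero_or_eq_normalForm y
  · exact absurd (by rw [← h1, mul_zero, zero_mul]) (normalForm_ne_zero a b)
  -- Cancelling the outer factors leaves two mutually inverse units `bc⁻¹` and `da⁻¹`.
  have cancel : ∀ {a b c d : FreeMonoid ι},
      normalForm a b * normalForm c d * normalForm a b = normalForm a b →
      (word b * wordInv c) * (word d * wordInv a) = 1 := by
    intro a b c d h
    have h3 := congrArg (fun z => word a * z * wordInv b) h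
    simp only [normalForm, ← mul_assoc, word_mul_wordInv_self, one_mul] at h3
    simpa only [mul_assoc, word_mul_wordInv_self, mul_one] using h3
  have h3 := cancel h1
  have h4 := cancel h2
  rw [eq_of_word_mul_wordInv_eq_one (eq_one_of_mul_eq_one h3 h4),
    eq_of_word_mul_wordInv_eq_one (eq_one_of_mul_eq_one h4 h3)]

theorem inversion_normalForm (a b : FreeMonoid ι) :
    isInverseSemigroup.inversion (normalForm a b) = normalForm b a :=
  (isInverseSemigroup.eq_inversion (isSemigroupInverse_normalForm a b)).symm

theorem inversion_zero : isInverseSemigroup.inversion (0 : PolycyclicMonoid ι) = 0 :=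
  (isInverseSemigroup.eq_inversion ⟨by simp, by simp⟩).symm

/-! ### Green's classes and convergence to zero -/

/-- The `ℛ`-class of the elements `c⁻¹b`. -/
def leftClass (c : FreeMonoid ι) : Set (PolycyclicMonoid ι) := Set.range fun b => normalForm c b

/-- The `ℒ`-class of the elements `a⁻¹c`. -/
def rightClass (c : FreeMonoid ι) : Set (PolycyclicMonoid ι) := Set.range fun a => normalForm a c

theorem zero_notMem_leftClass (c : FreeMonoid ι) : (0 : PolycyclicMonoid ι) ∉ leftClass c := by
  rintro ⟨b, h⟩
  exact normalForm_ne_zero _ _ h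

theorem zero_notMem_rightClass (c : FreeMonoid ι) : (0 : PolycyclicMonoid ι) ∉ rightClass c := by
  rintro ⟨b, h⟩
  exact normalForm_ne_zero _ _ h

@[simp] theorem normalForm_mem_leftClass {a b c : FreeMonoid ι} :
    normalForm a b ∈ leftClass c ↔ a = c := by
  refine ⟨?_, fun h => ⟨b, by rw [h]⟩⟩
  rintro ⟨d, h⟩
  exact (normalForm_inj.1 h).1.symm

@[simp] theorem normalForm_mem_rightClass {a b c : FreeMonoid ι} :
    normalForm a b ∈ rightClass c ↔ b = c := by
  refine ⟨?_, fun h => ⟨a, by rw [h]⟩⟩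
  rintro ⟨d, h⟩
  exact (normalForm_inj.1 h).2.symm

theorem tendsto_zero_iff {α : Type*} {l : Filter α} {f : α → PolycyclicMonoid ι} :
    Filter.Tendsto f l (𝓝 0) ↔
      ∀ c, (∀ᶠ t in l, f t ∉ leftClass c) ∧ ∀ᶠ t in l, f t ∉ rightClass c := by
  rw [nhds_zero_hasBasis.tendsto_right_iff]
  constructor
  · intro h c
    have hc := h {c} trivial
    constructor <;> filter_upwards [hc] with t ht <;>
      obtain ht | ⟨a, b, ha, hb, ht⟩ := ht
    · rw [ht]
      exact zero_notMem_leftClass c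
    · rw [ht]
      exact fun h' => ha (Finset.mem_singleton.2 (normalForm_mem_leftClass.1 h'))
    · rw [ht]
      exact zero_notMem_rightClass c
    · rw [ht]
      exact fun h' => hb (Finset.mem_singleton.2 (normalForm_mem_rightClass.1 h'))
  · intro h A _
    have hA : ∀ᶠ t in l, ∀ c ∈ (A : Set (FreeMonoid ι)), f t ∉ leftClass c ∧ f t ∉ rightClass c :=
      (Filter.eventually_all_finite A.finite_toSet).2 fun c _ => (h c).1.and (h c).2
    filter_upwards [hA] with t ht
    obtain h0 | ⟨a, b, hab⟩ := eq_zero_or_eq_normalForm (f t)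
    · exact Or.inl h0
    · rw [hab] at ht
      exact Or.inr ⟨a, b, fun ha => (ht a ha).1 (normalForm_mem_leftClass.2 rfl),
        fun hb => (ht b hb).2 (normalForm_mem_rightClass.2 rfl), hab⟩

theorem eventually_notMem_leftClass (c : FreeMonoid ι) :
    ∀ᶠ x in 𝓝 (0 : PolycyclicMonoid ι), x ∉ leftClass c :=
  (tendsto_zero_iff.1 Filter.tendsto_id c).1

theorem eventually_notMem_rightClass (c : FreeMonoid ι) :
    ∀ᶠ x in 𝓝 (0 : PolycyclicMonoid ι), x ∉ rightClass c :=
  (tendsto_zero_iff.1 Filter.tendsto_id c).2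

theorem nhds_of_ne_zero {x : PolycyclicMonoid ι} (hx : x ≠ 0) : 𝓝 x = pure x :=
  (isOpen_singleton_iff_nhds_eq_pure x).1 (isOpen_singleton_of_ne_zero hx)

theorem t2Space : T2Space (PolycyclicMonoid ι) := by
  have sep : ∀ x : PolycyclicMonoid ι, x ≠ 0 → Disjoint (𝓝 x) (𝓝 0) := by
    intro x hx
    rw [nhds_of_ne_zero hx]
    obtain h | ⟨a, b, rfl⟩ := eq_zero_or_eq_normalForm x
    · exact absurd h hx
    · rw [Filter.disjoint_iff]
      exact ⟨leftClass a, normalForm_mem_leftClass.2 rfl, (leftClass a)ᶜ,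
        eventually_notMem_leftClass a, disjoint_compl_right⟩
  rw [t2Space_iff_disjoint_nhds]
  intro x y hxy
  by_cases hx : x = 0
  · subst hx
    exact (sep y hxy.symm).symm
  by_cases hy : y = 0
  · subst hy
    exact sep x hxy
  rw [nhds_of_ne_zero hx, nhds_of_ne_zero hy]
  exact Filter.disjoint_pure_pure.2 hxy

theorem continuous_inversion :
    Continuous (isInverseSemigroup (ι := ι)).inversion := by
  rw [continuous_iff_continuousAt]
  intro x
  by_cases hx : x = 0
  · subst hx
    rw [ContinuousAt, inversion_zero, tendsto_zero_iff]
    intro c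
    constructor
    · filter_upwards [eventually_notMem_rightClass c] with x hx
      obtain rfl | ⟨a, b, rfl⟩ := eq_zero_or_eq_normalForm x
      · rw [inversion_zero]
        exact zero_notMem_leftClass c
      · simpa [inversion_normalForm] using hx
    · filter_upwards [eventually_notMem_leftClass c] with x hx
      obtain rfl | ⟨a, b, rfl⟩ := eq_zero_or_eq_normalForm x
      · rw [inversion_zero]
        exact zero_notMem_rightClass c
      · simpa [inversion_normalForm] using hx
  · rw [ContinuousAt, nhds_of_ne_zero hx]
    exact tendsto_pure_nhds _ _

/-! ### Continuity of multiplication -/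

theorem exists_suffix_of_mul_mem_leftClass {x y : PolycyclicMonoid ι} {c : FreeMonoid ι}
    (h : x * y ∈ leftClass c) : ∃ n ∈ {n | ∃ e, c = e * n}, x ∈ leftClass n := by
  obtain rfl | ⟨a, b, rfl⟩ := eq_zero_or_eq_normalForm x
  · exact absurd h (by rw [zero_mul]; exact zero_notMem_leftClass c)
  obtain rfl | ⟨m, n, rfl⟩ := eq_zero_or_eq_normalForm y
  · exact absurd h (by rw [mul_zero]; exact zero_notMem_leftClass c)
  refine ⟨a, ?_, normalForm_mem_leftClass.2 rfl⟩
  obtain ⟨e, -, h1⟩ | ⟨e, -, h1⟩ | h1 := normalForm_mul a b m n <;> rw [h1] at h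
  · exact ⟨1, by rw [one_mul, normalForm_mem_leftClass.1 h]⟩
  · exact ⟨e, (normalForm_mem_leftClass.1 h).symm⟩
  · exact absurd h (zero_notMem_leftClass c)

theorem exists_suffix_of_mul_mem_rightClass {x y : PolycyclicMonoid ι} {c : FreeMonoid ι}
    (h : x * y ∈ rightClass c) : ∃ n ∈ {n | ∃ e, c = e * n}, y ∈ rightClass n := by
  obtain rfl | ⟨a, b, rfl⟩ := eq_zero_or_eq_normalForm x
  · exact absurd h (by rw [zero_mul]; exact zero_notMem_rightClass c)
  obtain rfl | ⟨m, n, rfl⟩ := eq_zero_or_eq_normalForm y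
  · exact absurd h (by rw [mul_zero]; exact zero_notMem_rightClass c)
  refine ⟨n, ?_, normalForm_mem_rightClass.2 rfl⟩
  obtain ⟨e, -, h1⟩ | ⟨e, -, h1⟩ | h1 := normalForm_mul a b m n <;> rw [h1] at h
  · exact ⟨e, (normalForm_mem_rightClass.1 h).symm⟩
  · exact ⟨1, by rw [one_mul, normalForm_mem_rightClass.1 h]⟩
  · exact absurd h (zero_notMem_rightClass c)

/-- For fixed `x`, the `ℛ`-classes of those `y` for which `xy` lies in a given `ℛ`-class are finitely
many. -/
theorem finite_leftClass_of_mul_mem (x : PolycyclicMonoid ι) (c : FreeMonoid ι) :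
    ∃ F : Set (FreeMonoid ι), F.Finite ∧ ∀ y, x * y ∈ leftClass c → ∃ n ∈ F, y ∈ leftClass n := by
  obtain rfl | ⟨a, b, rfl⟩ := eq_zero_or_eq_normalForm x
  · exact ⟨∅, Set.finite_empty, fun y h =>
      absurd h (by rw [zero_mul]; exact zero_notMem_leftClass c)⟩
  have hfin : {e : FreeMonoid ι | e * a = c}.Finite :=
    Set.Subsingleton.finite fun e he e' he' => mul_right_cancel (he.trans he'.symm)
  refine ⟨{m | ∃ e, b = e * m} ∪ (· * b) '' {e | e * a = c},
    b.finite_suffixes.union (hfin.image _), fun y h => ?_⟩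
  obtain rfl | ⟨m, n, rfl⟩ := eq_zero_or_eq_normalForm y
  · exact absurd h (by rw [mul_zero]; exact zero_notMem_leftClass c)
  refine ⟨m, ?_, normalForm_mem_leftClass.2 rfl⟩
  obtain ⟨e, h2, h1⟩ | ⟨e, h2, h1⟩ | h1 := normalForm_mul a b m n <;> rw [h1] at h
  · exact Or.inl ⟨e, h2⟩
  · exact Or.inr ⟨e, normalForm_mem_leftClass.1 h, h2.symm⟩
  · exact absurd h (zero_notMem_leftClass c)

theorem finite_rightClass_of_mul_mem (y : PolycyclicMonoid ι) (c : FreeMonoid ι) :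
    ∃ F : Set (FreeMonoid ι), F.Finite ∧
      ∀ x, x * y ∈ rightClass c → ∃ n ∈ F, x ∈ rightClass n := by
  obtain rfl | ⟨m, n, rfl⟩ := eq_zero_or_eq_normalForm y
  · exact ⟨∅, Set.finite_empty, fun x h =>
      absurd h (by rw [mul_zero]; exact zero_notMem_rightClass c)⟩
  have hfin : {e : FreeMonoid ι | e * n = c}.Finite :=
    Set.Subsingleton.finite fun e he e' he' => mul_right_cancel (he.trans he'.symm)
  refine ⟨{b | ∃ e, m = e * b} ∪ (· * m) '' {e | e * n = c},
    m.finite_suffixes.union (hfin.image _), fun x h => ?_⟩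
  obtain rfl | ⟨a, b, rfl⟩ := eq_zero_or_eq_normalForm x
  · exact absurd h (by rw [zero_mul]; exact zero_notMem_rightClass c)
  refine ⟨b, ?_, normalForm_mem_rightClass.2 rfl⟩
  obtain ⟨e, h2, h1⟩ | ⟨e, h2, h1⟩ | h1 := normalForm_mul a b m n <;> rw [h1] at h
  · exact Or.inr ⟨e, normalForm_mem_rightClass.1 h, h2.symm⟩
  · exact Or.inl ⟨e, h2⟩
  · exact absurd h (zero_notMem_rightClass c)

theorem eventually_forall_notMem_leftClass {F : Set (FreeMonoid ι)} (hF : F.Finite) :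
    ∀ᶠ x in 𝓝 (0 : PolycyclicMonoid ι), ¬ ∃ n ∈ F, x ∈ leftClass n := by
  simpa only [not_exists, not_and] using
    (Filter.eventually_all_finite hF).2 fun n _ => eventually_notMem_leftClass n

theorem eventually_forall_notMem_rightClass {F : Set (FreeMonoid ι)} (hF : F.Finite) :
    ∀ᶠ x in 𝓝 (0 : PolycyclicMonoid ι), ¬ ∃ n ∈ F, x ∈ rightClass n := by
  simpa only [not_exists, not_and] using
    (Filter.eventually_all_finite hF).2 fun n _ => eventually_notMem_rightClass n

theorem continuous_mul : Continuous fun x : PolycyclicMonoid ι × PolycyclicMonoid ι =>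
    x.1 * x.2 := by
  rw [continuous_iff_continuousAt]
  rintro ⟨x, y⟩
  rw [ContinuousAt, nhds_prod_eq]
  by_cases hx : x = 0
  · subst hx
    rw [zero_mul, tendsto_zero_iff]
    refine fun c => ⟨?_, ?_⟩
    · exact ((eventually_forall_notMem_leftClass c.finite_suffixes).prod_inl _).mono
        fun z hz h => hz (exists_suffix_of_mul_mem_leftClass h)
    · by_cases hy : y = 0
      · subst hy
        exact ((eventually_forall_notMem_rightClass c.finite_suffixes).prod_inr _).mono
          fun z hz h => hz (exists_suffix_of_mul_mem_rightClass h)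
      · obtain ⟨F, hF, hFc⟩ := finite_rightClass_of_mul_mem y c
        rw [nhds_of_ne_zero hy, Filter.prod_pure, Filter.eventually_map]
        exact (eventually_forall_notMem_rightClass hF).mono fun z hz h => hz (hFc z h)
  · rw [nhds_of_ne_zero hx]
    by_cases hy : y = 0
    · subst hy
      rw [mul_zero, Filter.pure_prod, tendsto_zero_iff]
      refine fun c => ⟨?_, ?_⟩ <;> rw [Filter.eventually_map]
      · obtain ⟨F, hF, hFc⟩ := finite_leftClass_of_mul_mem x c
        exact (eventually_forall_notMem_leftClass hF).mono fun z hz h => hz (hFc z h)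
      · exact (eventually_forall_notMem_rightClass c.finite_suffixes).mono
          fun z hz h => hz (exists_suffix_of_mul_mem_rightClass h)
    · rw [nhds_of_ne_zero hy, Filter.pure_prod, Filter.map_pure]
      exact tendsto_pure_nhds (fun z : PolycyclicMonoid ι × PolycyclicMonoid ι => z.1 * z.2) (x, y)

theorem isTopologicalInverseSemigroup : IsTopologicalInverseSemigroup (PolycyclicMonoid ι) where
  hausdorff := t2Space
  inverse := isInverseSemigroup
  continuous_mul := continuous_mul
  continuous_inversion := continuous_inversion

/-! ### Continuous homomorphic images are closed -/

/-- If `l` eventually avoids every `ℛ`-class, then `s s⁻¹` tends to zero along `l`: for `s = a⁻¹b` it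
equals `a⁻¹a`, which lies only in the `ℛ`-class and the `ℒ`-class of `a`. -/
theorem tendsto_mul_inversion {l : Filter (PolycyclicMonoid ι)}
    (h : ∀ c, ∀ᶠ s in l, s ∉ leftClass c) :
    Filter.Tendsto (fun s => s * isInverseSemigroup.inversion s) l (𝓝 0) := by
  rw [tendsto_zero_iff]
  refine fun c => ⟨?_, ?_⟩ <;> filter_upwards [h c] with s hs <;>
    obtain rfl | ⟨a, b, rfl⟩ := eq_zero_or_eq_normalForm s
  · simpa using zero_notMem_leftClass c
  · simpa [inversion_normalForm, normalForm_mul_normalForm] using hs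
  · simpa using zero_notMem_rightClass c
  · simpa [inversion_normalForm, normalForm_mul_normalForm] using hs

theorem tendsto_inversion_mul {l : Filter (PolycyclicMonoid ι)}
    (h : ∀ c, ∀ᶠ s in l, s ∉ rightClass c) :
    Filter.Tendsto (fun s => isInverseSemigroup.inversion s * s) l (𝓝 0) := by
  rw [tendsto_zero_iff]
  refine fun c => ⟨?_, ?_⟩ <;> filter_upwards [h c] with s hs <;>
    obtain rfl | ⟨a, b, rfl⟩ := eq_zero_or_eq_normalForm s
  · simpa using zero_notMem_leftClass c
  · simpa [inversion_normalForm, normalForm_mul_normalForm] using hs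
  · simpa using zero_notMem_rightClass c
  · simpa [inversion_normalForm, normalForm_mul_normalForm] using hs

/-- Every continuous homomorphism into a topological inverse semigroup has closed range. This covers
the subspace topology on any image, since a homomorphism from `h(P_λ)` can be composed with `h`. -/
theorem isClosed_range {T : Type*} [Semigroup T] [TopologicalSpace T]
    (hT : IsTopologicalInverseSemigroup T) (g : PolycyclicMonoid ι →ₙ* T) (hg : Continuous g) :
    IsClosed (Set.range g) := by
  have := hT.hausdorff
  have : ContinuousMul T := ⟨hT.continuous_mul⟩
  rw [← closure_subset_iff_isClosed]
  intro x hx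
  obtain ⟨U, hU⟩ : ∃ U : Ultrafilter (PolycyclicMonoid ι), Filter.Tendsto g U (𝓝 x) := by
    have : (Filter.comap g (𝓝 x)).NeBot := Filter.comap_neBot_iff.2 fun t ht => by
      obtain ⟨_, hyt, s, rfl⟩ := mem_closure_iff_nhds.1 hx t ht
      exact ⟨s, hyt⟩
    exact ⟨Ultrafilter.of _, Filter.tendsto_comap.mono_left (Ultrafilter.of_le _)⟩
  have hinv : Filter.Tendsto (fun s => g (isInverseSemigroup.inversion s)) U
      (𝓝 (hT.inverse.inversion x)) := by
    simp only [isInverseSemigroup.map_inversion hT.inverse]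
    exact (hT.continuous_inversion.tendsto x).comp hU
  obtain ⟨hxx, -⟩ := hT.inverse.inversion_spec x
  by_cases hL : ∃ a, leftClass a ∈ U
  · obtain ⟨a, ha⟩ := hL
    by_cases hR : ∃ b, rightClass b ∈ U
    · obtain ⟨b, hb⟩ := hR
      refine ⟨normalForm a b, tendsto_nhds_unique (f := g) ?_ hU⟩
      refine tendsto_const_nhds.congr' ?_
      filter_upwards [ha, hb] with s hsa hsb
      obtain ⟨c, rfl⟩ := hsa
      rw [normalForm_mem_rightClass.1 hsb]
    · refine ⟨0, ?_⟩
      have h1 := tendsto_inversion_mul (l := (U : Filter (PolycyclicMonoid ι))) fun c =>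
        Ultrafilter.compl_mem_iff_notMem.2 fun h => hR ⟨c, h⟩
      have h2 : hT.inverse.inversion x * x = g 0 := by
        refine tendsto_nhds_unique (hinv.mul hU) (((hg.tendsto 0).comp h1).congr fun s => ?_)
        exact map_mul g _ _
      have h3 : x * g 0 = g 0 := by
        refine tendsto_nhds_unique (hU.mul_const (g 0)) (tendsto_const_nhds.congr fun s => ?_)
        rw [← map_mul, mul_zero]
      rw [← h3, ← h2, ← mul_assoc, hxx]
  · refine ⟨0, ?_⟩
    have h1 := tendsto_mul_inversion (l := (U : Filter (PolycyclicMonoid ι))) fun c =>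
      Ultrafilter.compl_mem_iff_notMem.2 fun h => hL ⟨c, h⟩
    have h2 : x * hT.inverse.inversion x = g 0 := by
      refine tendsto_nhds_unique (hU.mul hinv) (((hg.tendsto 0).comp h1).congr fun s => ?_)
      exact map_mul g _ _
    have h3 : g 0 * x = g 0 := by
      refine tendsto_nhds_unique (hU.const_mul (g 0)) (tendsto_const_nhds.congr fun s => ?_)
      rw [← map_mul, zero_mul]
    rw [← h3, ← h2, hxx]

end PolycyclicMonoid

theorem corollary5p12 (ι : Type u) [Nonempty ι] :
    IsTopologicalInverseSemigroup (PolycyclicMonoid ι) ∧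
      IsAbsolutelyHClosed.{u, v, w} (PolycyclicMonoid ι) := by
  refine ⟨PolycyclicMonoid.isTopologicalInverseSemigroup,
    PolycyclicMonoid.isTopologicalInverseSemigroup, fun T _ _ hT h hh =>
      ⟨hT.srange PolycyclicMonoid.isInverseSemigroup h, fun T' _ _ hT' f hf => ?_⟩⟩
  let r : PolycyclicMonoid ι →ₙ* h.srange := h.srangeRestrict
  have hr : Continuous r := hh.subtype_mk _
  have hsurj : Function.Surjective r := h.srangeRestrict_surjective
  have hclosed := PolycyclicMonoid.isClosed_range hT' (f.comp r) (hf.continuous.comp hr)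
  rwa [MulHom.coe_comp, hsurj.range_comp] at hclosed
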